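/- For permutations (patterns) $\sigma,\tau$ let $\mathrm{Av}(\sigma\mid\tau)$ be the set of all finite permutations that can be written, in one-line notation, as a concatenation $AB$ in which $A$ avoids $\sigma$ and $B$ avoids $\tau$ (either part may be empty). There is a size-preserving bijection $$\phi:\ \mathrm{Av}(312\mid 21)\longrightarrow \mathrm{Av}(312\mid 12)$$ which acts on decorated Dyck paths as described below. *Decorated Dyck paths.* Let $P$ be in one of the two classes and write $P=P_1P_2$, where $P_1$ is as long as possible subject to $P_1$ avoiding $312$ and $P_2$ avoiding $21$ (respectively $12$). Let $m=|P_1|$. The Dyck path $\mathcal P$ of $P_1$ is the path from $(0,0)$ to $(m,m)$ with up and right steps, staying weakly above the diagonal, whose corners (an up step followed by a right step) contain the left-to-right maxima of the diagram of $P_1$ (entries of $P_1$ standardised to $1,\dots,m$); that is, its height over the $i$-th column is the maximum of the first $i$ entries. For $1\le i\le m$ let $h_i$ be the number of entries of $P_2$ whose values lie immediately above the $i$-th smallest entry of $P_1$ (between it and the next larger entry of $P_1$, if any) when $P\in\mathrm{Av}(312\mid 21)$, and immediately below the $i$-th smallest entry of $P_1$ (between it and the next smaller entry of $P_1$, if any)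 when $P\in\mathrm{Av}(312\mid 12)$. Thus $h_P=(h_1,\dots,h_m)$ assigns a label $h_i$ to the $i$-th up step of $\mathcal P$. Decompose $\mathcal P=\mathcal P_1\oplus\cdots\oplus\mathcal P_k$ into excursions (non-empty sections that meet the diagonal only at their two ends); each excursion carries the labels of its own up steps. *The action of $\phi$.* Let $P\in\mathrm{Av}(312\mid 21)$ have path $\mathcal P=\mathcal P_1\oplus\cdots\oplus\mathcal P_k$ and labels $h_P$. If some label is nonzero, let $\mathcal P_i$ (the middle excursion) be the first excursion with a nonzero label, and let $\mathcal Q_i$ be the excursion of the same shape with the sequence of labels of its up steps reversed. Then $\phi(P)$ is a permutation whose labelled Dyck path is $$\mathcal P_{i+1}\oplus\cdots\oplus\mathcal P_k\oplus\mathcal Q_i\oplus\mathcal P_1\oplus\cdots\oplus\mathcal P_{i-1},$$ where every excursion other than $\mathcal P_i$ keeps its labels. If all labels are zero, then $\phi(P)$ has the same labelled Dyck path as $P$. -/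

import Mathlib

/-- A permutation of some finite size `n`, the entries being `0, …, n - 1`. -/
abbrev FinitePerm : Type := Σ n : ℕ, Equiv.Perm (Fin n)

namespace FinitePerm

/-- The number of points of a permutation. -/
abbrev size (π : FinitePerm) : ℕ := π.1

/-- The subsequence of `π` at the positions in `S` avoids the pattern `p` (given in one-line
notation): no choice of positions in `S` carries entries in the same relative order as `p`. -/
def AvoidsOn (π : FinitePerm) {k : ℕ} (p : Fin k → ℕ) (S : Set (Fin π.size)) : Prop :=
  ¬ ∃ f : Fin k ↪o Fin π.size,
      (∀ i, f i ∈ S) ∧ ∀ i j, π.2 (f i) < π.2 (f j) ↔ p i < p j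

/-- `m` is the position of a vertical gridline showing that `π` is a `p`-avoider (the first `m`
entries) followed by a `q`-avoider (the remaining entries). -/
def IsGridding (π : FinitePerm) {k l : ℕ} (p : Fin k → ℕ) (q : Fin l → ℕ) (m : ℕ) : Prop :=
  m ≤ π.size ∧ π.AvoidsOn p {i | i.val < m} ∧ π.AvoidsOn q {i | m ≤ i.val}

/-- The juxtaposition class `Av(p | q)`. -/
def juxtaposition {k l : ℕ} (p : Fin k → ℕ) (q : Fin l → ℕ) : Set FinitePerm :=
  {π | ∃ m, π.IsGridding p q m}

/-- `m` is the gridline of the gridding of `π` in `Av(p | q)` with the most points on the left. -/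
def IsRightmostGridding (π : FinitePerm) {k l : ℕ} (p : Fin k → ℕ) (q : Fin l → ℕ)
    (m : ℕ) : Prop :=
  IsGreatest {m | π.IsGridding p q m} m

/-- Among the first `m` entries of `π`, the number of those that do not exceed the maximum of the
first `c` entries: this is the height over column `c` of the lowest up-right path that stays
above the points left of the gridline `m`. -/
def leftHeight (π : FinitePerm) (m c : ℕ) : ℕ :=
  (Finset.univ.filter fun j : Fin π.size =>
    j.val < m ∧ ∃ k : Fin π.size, k.val < c ∧ π.2 j ≤ π.2 k).card

/-- The steps of the Dyck path of the first `m` entries of `π`: it runs from bottom left to top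
right above the diagonal and its corners (an up step followed by a right step) hold the
left-to-right maxima. Up steps are `DyckStep.U`, right steps are `DyckStep.D`. -/
def leftPath (π : FinitePerm) (m : ℕ) : List DyckStep :=
  (List.range m).flatMap fun c =>
    List.replicate (π.leftHeight m (c + 1) - π.leftHeight m c) DyckStep.U ++ [DyckStep.D]

/-- The number of points right of the gridline `m` that have exactly `g` of the points left of
the gridline below them. -/
def gapCount (π : FinitePerm) (m g : ℕ) : ℕ :=
  (Finset.univ.filter fun r : Fin π.size => m ≤ r.val ∧
    (Finset.univ.filter fun j : Fin π.size => j.val < m ∧ π.2 j < π.2 r).card = g).card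

/-- Entry number `i` is the number of points on the right that lie immediately above the `i`-th
lowest point on the left, i.e. the one in the row of the `i`-th up step (`i = 1, …, m`). -/
def lengthsAbove (π : FinitePerm) (m : ℕ) : List ℕ :=
  (List.range m).map fun i => π.gapCount m (i + 1)

/-- Entry number `i` is the number of points on the right that lie immediately below the `i`-th
lowest point on the left, i.e. the one in the row of the `i`-th up step (`i = 1, …, m`). -/
def lengthsBelow (π : FinitePerm) (m : ℕ) : List ℕ :=
  (List.range m).map fun i => π.gapCount m i

end FinitePerm

/-- A Dyck path together with one number for each of its up steps. -/
abbrev DecoratedPath : Type := DyckWord × List ℕ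

/-- `L` is the decomposition into excursions of the path with steps `w` whose up steps are
labelled, in order, by `h`; each excursion carries the labels of its own up steps. -/
def IsExcursionDecomposition (w : List DyckStep) (h : List ℕ) (L : List DecoratedPath) : Prop :=
  (∀ e ∈ L, e.1.IsNested ∧ e.2.length = e.1.semilength) ∧
    (L.map Prod.fst).sum.toList = w ∧ (L.map Prod.snd).flatten = h

/-- The middle excursion is the first one that has a nonzero label. It keeps its shape and has its
labels reversed; the excursions before it and the excursions after it change places. If all labels
are zero then there is no middle excursion and nothing is changed. -/
def reshuffle (L : List DecoratedPath) : List DecoratedPath :=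
  let A := L.takeWhile fun e => e.2.all (· == 0)
  match L.dropWhile fun e => e.2.all (· == 0) with
  | [] => A
  | M :: B => B ++ (M.1, M.2.reverse) :: A

/-! ### Pattern avoidance and griddings in explicit form -/

namespace FinitePerm

open Finset

/-! A gridded permutation is the same thing as a Dyck path of semilength `m` together with `m + 1`
arbitrary gap counts. The gap counts fix the set of values on the left, a `312`-avoider on given
values is determined by its path, and a monotone sequence is determined by its values. This is
`eq_of_leftHeight_eq_of_gapCount_eq` (uniqueness) and `exists_gridding` (existence).

The gridline is rightmost exactly when moving it past the first right point `x` would create a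
`312`, that is, when some left descent straddles `x`. If `x` has `g` left points below it, there is
no such descent iff those `g` points occupy the first `g` positions, iff the path meets the diagonal
at `(g, g)`. So the gridline is rightmost iff the first nonempty gap, read upwards for `21` and
downwards for `12`, is not at a point where the path meets the diagonal (`isGreatest_gridding_iff`).

In terms of labels, the condition for `21` says that gap `0` is empty and that the first nonzero
label is not on the last up step of its excursion. For `12` it says that gap `m` is empty and that
the last nonzero label is not on the first up step of its excursion. Both classes thus become sets
of lists of labelled excursions (`exists_equiv_encodes`). For `21`, write the list as `A M B` with
`A` all zero and `M` not; validity then depends on `M` alone. In the reshuffled list, `B`, reversed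
`M`, `A`, the reversed `M` is the last excursion with a nonzero label, and its validity is the
mirror image of that of `M` (`validBelow_reshuffle_iff`). Reshuffling followed by a full reversal is
an involution, so reshuffling is bijective. It only permutes the labels, and the size is the number
of labels plus their sum, so sizes agree. -/

lemma avoidsOn_312_iff (π : FinitePerm) (m : ℕ) :
    π.AvoidsOn ![3, 1, 2] {i | i.val < m} ↔ ∀ a b c : Fin π.size, a < b → b < c → c.val < m →
      π.2 b < π.2 c → ¬ π.2 c < π.2 a := by
  constructor
  · intro h a b c hab hbc hc h1 h2
    refine h ⟨OrderEmbedding.ofStrictMono ![a, b, c] ?_, ?_, ?_⟩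
    · intro i j hij
      fin_cases i <;> fin_cases j <;> simp_all <;> order
    · intro i
      change (![a, b, c] i).val < m
      fin_cases i <;> simp <;> omega
    · intro i j
      change π.2 (![a, b, c] i) < π.2 (![a, b, c] j) ↔ _
      fin_cases i <;> fin_cases j <;> simp <;> omega
  · rintro h ⟨f, hf, hp⟩
    exact h (f 0) (f 1) (f 2) (by simp) (by simp) (hf 2) ((hp 1 2).2 (by simp))
      ((hp 2 0).2 (by simp))

lemma avoidsOn_21_iff (π : FinitePerm) (m : ℕ) :
    π.AvoidsOn ![2, 1] {i | m ≤ i.val} ↔ ∀ a b : Fin π.size, m ≤ a.val → a < b →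
      (π.2 a).val < (π.2 b).val := by
  constructor
  · intro h a b ha hab
    by_contra h1
    have h2 : π.2 b < π.2 a := lt_of_le_of_ne (not_lt.1 h1) fun e => hab.ne' (π.2.injective e)
    refine h ⟨OrderEmbedding.ofStrictMono ![a, b] ?_, ?_, ?_⟩
    · intro i j hij
      fin_cases i <;> fin_cases j <;> simp_all
    · intro i
      change m ≤ (![a, b] i).val
      fin_cases i <;> simp <;> omega
    · intro i j
      change π.2 (![a, b] i) < π.2 (![a, b] j) ↔ _
      fin_cases i <;> fin_cases j <;> simp <;> omega
  · rintro h ⟨f, hf, hp⟩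
    exact lt_asymm (h (f 0) (f 1) (hf 0) (by simp)) ((hp 1 0).2 (by simp))

lemma avoidsOn_12_iff (π : FinitePerm) (m : ℕ) :
    π.AvoidsOn ![1, 2] {i | m ≤ i.val} ↔ ∀ a b : Fin π.size, m ≤ a.val → a < b →
      (π.2 a).val > (π.2 b).val := by
  constructor
  · intro h a b ha hab
    by_contra h1
    have h2 : π.2 a < π.2 b := lt_of_le_of_ne (not_lt.1 h1) fun e => hab.ne (π.2.injective e)
    refine h ⟨OrderEmbedding.ofStrictMono ![a, b] ?_, ?_, ?_⟩
    · intro i j hij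
      fin_cases i <;> fin_cases j <;> simp_all
    · intro i
      change m ≤ (![a, b] i).val
      fin_cases i <;> simp <;> omega
    · intro i j
      change π.2 (![a, b] i) < π.2 (![a, b] j) ↔ _
      fin_cases i <;> fin_cases j <;> simp <;> omega
  · rintro h ⟨f, hf, hp⟩
    exact lt_asymm (h (f 0) (f 1) (hf 0) (by simp)) ((hp 0 1).2 (by simp))

/-- The points right of the gridline `m` form an `r`-monotone sequence. -/
def RightMonotone (π : FinitePerm) (r : ℕ → ℕ → Prop) (m : ℕ) : Prop :=
  ∀ a b : Fin π.size, m ≤ a.val → a < b → r (π.2 a).val (π.2 b).val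

/-- The points left of the gridline `m` avoid `312`. -/
def LeftAvoids (π : FinitePerm) (m : ℕ) : Prop :=
  ∀ a b c : Fin π.size, a < b → b < c → c.val < m → π.2 b < π.2 c → ¬ π.2 c < π.2 a

/-- `m` is the position of a gridline with a `312`-avoider on its left and an `r`-monotone
sequence on its right. -/
def Gridding (π : FinitePerm) (r : ℕ → ℕ → Prop) (m : ℕ) : Prop :=
  m ≤ π.size ∧ π.LeftAvoids m ∧ π.RightMonotone r m

lemma isGridding_21_iff (π : FinitePerm) (m : ℕ) :
    π.IsGridding ![3, 1, 2] ![2, 1] m ↔ π.Gridding (· < ·) m := by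
  rw [IsGridding, avoidsOn_312_iff, avoidsOn_21_iff]; rfl

lemma isGridding_12_iff (π : FinitePerm) (m : ℕ) :
    π.IsGridding ![3, 1, 2] ![1, 2] m ↔ π.Gridding (· > ·) m := by
  rw [IsGridding, avoidsOn_312_iff, avoidsOn_12_iff]; rfl

/-! ### Ranks, gap counts and the values on the left -/

/-- The number of points left of the gridline `m` with value below `x`. -/
def leftRank (π : FinitePerm) (m : ℕ) (x : Fin π.size) : ℕ :=
  (univ.filter fun j : Fin π.size => j.val < m ∧ π.2 j < x).card

lemma card_filter_val_lt {n m : ℕ} (h : m ≤ n) :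
    (univ.filter fun j : Fin n => j.val < m).card = m := by
  rw [Fin.card_filter_val_lt, min_eq_right h]

lemma leftRank_mono (π : FinitePerm) (m : ℕ) : Monotone (π.leftRank m) := fun x y h =>
  card_le_card fun j hj => by
    simp only [mem_filter_univ] at hj ⊢
    exact ⟨hj.1, hj.2.trans_le h⟩

lemma leftRank_lt {π : FinitePerm} {m : ℕ} {i : Fin π.size} {x : Fin π.size} (hi : i.val < m)
    (h : π.2 i < x) : π.leftRank m (π.2 i) < π.leftRank m x := by
  refine card_lt_card ⟨fun j hj => ?_, fun hs => ?_⟩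
  · simp only [mem_filter_univ] at hj ⊢
    exact ⟨hj.1, hj.2.trans h⟩
  · simpa using hs (by simpa using ⟨hi, h⟩ : i ∈ _)

lemma leftRank_le {π : FinitePerm} {m : ℕ} (hm : m ≤ π.size) (x : Fin π.size) :
    π.leftRank m x ≤ m :=
  (card_le_card fun j hj => by simp only [mem_filter_univ] at hj ⊢; exact hj.1).trans_eq
    (card_filter_val_lt hm)

lemma leftRank_left_lt {π : FinitePerm} {m : ℕ} (hm : m ≤ π.size) {i : Fin π.size}
    (hi : i.val < m) : π.leftRank m (π.2 i) < m := by
  conv_rhs => rw [← card_filter_val_lt hm]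
  refine card_lt_card ⟨fun j hj => ?_, fun hs => ?_⟩
  · simp only [mem_filter_univ] at hj ⊢
    exact hj.1
  · simpa using hs (by simpa using hi : i ∈ _)

lemma gapCount_eq (π : FinitePerm) (m g : ℕ) : π.gapCount m g =
    (univ.filter fun j : Fin π.size => m ≤ j.val ∧ π.leftRank m (π.2 j) = g).card := rfl

lemma gapCount_eq_zero_iff (π : FinitePerm) (m g : ℕ) : π.gapCount m g = 0 ↔
    ∀ j : Fin π.size, m ≤ j.val → π.leftRank m (π.2 j) ≠ g := by
  rw [gapCount_eq, card_eq_zero, filter_eq_empty_iff]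
  simp

lemma sum_gapCount (π : FinitePerm) (m k : ℕ) : ∑ g ∈ range k, π.gapCount m g =
    (univ.filter fun j : Fin π.size => m ≤ j.val ∧ π.leftRank m (π.2 j) < k).card := by
  rw [card_eq_sum_card_fiberwise (t := range k) (f := fun j => π.leftRank m (π.2 j))]
  · refine sum_congr rfl fun g hg => ?_
    rw [gapCount_eq, filter_filter]
    congr 1
    ext j
    simp only [mem_filter_univ, mem_range] at hg ⊢
    constructor
    · rintro ⟨h, rfl⟩; exact ⟨⟨h, hg⟩, rfl⟩
    · rintro ⟨⟨h, -⟩, rfl⟩; exact ⟨h, rfl⟩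
  · intro j hj
    simp at hj ⊢
    exact hj.2

lemma size_eq {π : FinitePerm} {m : ℕ} (hm : m ≤ π.size) :
    π.size = m + ∑ g ∈ range (m + 1), π.gapCount m g := by
  have h := card_filter_add_card_filter_not (s := (univ : Finset (Fin π.size)))
    (fun j : Fin π.size => j.val < m)
  rw [card_filter_val_lt hm, card_univ, Fintype.card_fin] at h
  rw [← h, sum_gapCount]
  congr 2
  ext j
  simp [leftRank_le hm]

/-- Below a left point lie the left points of smaller rank and the right points in the gaps up to
its own rank. Hence the gap counts alone determine the value set of the left part. -/
lemma left_val_eq (π : FinitePerm) (m : ℕ) {i : Fin π.size} (hi : i.val < m) :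
    (π.2 i).val = π.leftRank m (π.2 i) +
      ∑ g ∈ range (π.leftRank m (π.2 i) + 1), π.gapCount m g := by
  have h1 : (univ.filter fun j : Fin π.size => π.2 j < π.2 i).card = (π.2 i).val := by
    rw [← Fin.card_Iio (π.2 i)]
    exact card_equiv π.2 (by simp)
  have h := card_filter_add_card_filter_not
    (s := univ.filter fun j : Fin π.size => π.2 j < π.2 i) (fun j : Fin π.size => j.val < m)
  rw [h1] at h
  rw [← h, sum_gapCount]
  congr 1
  · rw [filter_filter, leftRank]
    congr 1; ext j; simp [and_comm]
  · rw [filter_filter]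
    congr 1; ext j
    simp only [mem_filter_univ, not_lt, Nat.lt_succ_iff]
    constructor
    · rintro ⟨h, hj⟩; exact ⟨hj, leftRank_mono π m h.le⟩
    · rintro ⟨hj, h⟩
      refine ⟨?_, hj⟩
      by_contra h'
      have : π.2 i < π.2 j := lt_of_le_of_ne (not_lt.1 h') fun e => by
        have := π.2.injective e; subst this; omega
      exact absurd (leftRank_lt hi this) (by omega)

lemma image_left {π : FinitePerm} {m : ℕ} (hm : m ≤ π.size) :
    ((univ.filter fun i : Fin π.size => i.val < m).image fun i => (π.2 i).val) =
      (range m).image fun t => t + ∑ g ∈ range (t + 1), π.gapCount m g := by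
  refine eq_of_subset_of_card_le (fun x hx => ?_) ?_
  · simp only [mem_image, mem_filter_univ, mem_range] at hx ⊢
    obtain ⟨i, hi, rfl⟩ := hx
    exact ⟨_, leftRank_left_lt hm hi, (left_val_eq π m hi).symm⟩
  · rw [card_image_of_injective (f := fun i => (π.2 i).val) _
      (Fin.val_injective.comp π.2.injective), card_filter_val_lt hm]
    exact card_image_le.trans (by simp)

/-! ### Path and gap counts determine the gridded permutation -/

lemma leftHeight_zero (π : FinitePerm) (m : ℕ) : π.leftHeight m 0 = 0 := by
  simp [leftHeight]

lemma leftHeight_mono (π : FinitePerm) (m : ℕ) : Monotone (π.leftHeight m) := fun c d h =>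
  card_le_card fun j hj => by
    simp only [mem_filter_univ] at hj ⊢
    obtain ⟨h1, k, h2, h3⟩ := hj
    exact ⟨h1, k, by omega, h3⟩

lemma le_leftHeight {π : FinitePerm} {m c : ℕ} (hm : m ≤ π.size) (hc : c ≤ m) :
    c ≤ π.leftHeight m c := by
  conv_lhs => rw [← card_filter_val_lt (hc.trans hm)]
  refine card_le_card fun j hj => ?_
  simp only [mem_filter_univ] at hj ⊢
  exact ⟨by omega, j, hj, le_rfl⟩

lemma leftHeight_self {π : FinitePerm} {m : ℕ} (hm : m ≤ π.size) : π.leftHeight m m = m := by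
  refine le_antisymm ?_ (le_leftHeight hm le_rfl)
  conv_rhs => rw [← card_filter_val_lt hm]
  exact card_le_card fun j hj => by simp only [mem_filter_univ] at hj ⊢; exact hj.1

lemma leftHeight_eq_card_image {n : ℕ} (p : Equiv.Perm (Fin n)) (m c : ℕ) :
    leftHeight ⟨n, p⟩ m c = (((univ.filter fun i : Fin n => i.val < m).image p).filter
      fun x => ∃ k : Fin n, k.val < c ∧ x ≤ p k).card := by
  rw [filter_image, card_image_of_injective _ p.injective, filter_filter]
  rfl

/-- Consider a first difference `c` with `p c < p' c`. If `p' c` lies below an earlier entry, then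
in `p` that value comes after `c` and completes a `312` with the earlier entry and `p c`. Otherwise
`p' c` is a new maximum, and the path of `p'` is strictly higher there. -/
lemma not_lt_of_leftHeight_eq {n : ℕ} {p p' : Equiv.Perm (Fin n)} {m : ℕ}
    (hV : (univ.filter fun i : Fin n => i.val < m).image p =
      (univ.filter fun i : Fin n => i.val < m).image p')
    (hp : LeftAvoids ⟨n, p⟩ m) {c : Fin n} (hc : c.val < m)
    (hH : leftHeight ⟨n, p⟩ m (c + 1) = leftHeight ⟨n, p'⟩ m (c + 1))
    (agree : ∀ k < c, p k = p' k) : ¬ p c < p' c := by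
  intro hlt
  by_cases h : ∃ k < c, p' c ≤ p' k
  · obtain ⟨k, hk, hle⟩ := h
    have : p' c ∈ (univ.filter fun i : Fin n => i.val < m).image p := by
      rw [hV]; exact mem_image_of_mem _ (by simpa using hc)
    obtain ⟨j, hj, e⟩ := mem_image.1 this
    simp only [mem_filter_univ] at hj
    have hcj : c < j := by
      rcases lt_trichotomy c j with h | h | h
      · exact h
      · subst h; exact absurd e hlt.ne
      · have := agree j h
        rw [e] at this
        exact absurd (p'.injective this) h.ne'
    refine hp k c j hk hcj hj (by simpa [e] using hlt) ?_
    have : p' c < p' k := lt_of_le_of_ne hle fun e => hk.ne' (p'.injective e)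
    simpa [e, agree k hk] using this
  · push Not at h
    rw [leftHeight_eq_card_image, leftHeight_eq_card_image, hV] at hH
    refine hH.not_lt (card_lt_card ⟨fun x hx => ?_, fun hs => ?_⟩)
    · simp only [mem_filter] at hx ⊢
      obtain ⟨hx, k, hk, hxk⟩ := hx
      refine ⟨hx, c, by omega, ?_⟩
      rcases (show k ≤ c by omega).lt_or_eq with hk | rfl
      · rw [agree k hk] at hxk
        exact hxk.trans (h k hk).le
      · exact hxk.trans hlt.le
    · have : p' c ∈ _ := hs (mem_filter.2 ⟨mem_image_of_mem _ (by simpa using hc), c, by simp,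
        le_rfl⟩)
      obtain ⟨-, k, hk, hxk⟩ := mem_filter.1 this
      rcases (show k ≤ c by omega).lt_or_eq with hk | rfl
      · rw [agree k hk] at hxk
        exact (h k hk).not_ge hxk
      · exact hlt.not_ge hxk

/-- The value `p c` also occurs on the right in `p'`. Its position there cannot precede `c`, by
agreement, nor can it be `c` or later, by monotonicity. -/
lemma not_rel_of_rightMonotone {n : ℕ} {p p' : Equiv.Perm (Fin n)} {r : ℕ → ℕ → Prop}
    [IsStrictOrder ℕ r] {m : ℕ}
    (hV : ∀ x, (p.symm x).val < m ↔ (p'.symm x).val < m)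
    (hp' : RightMonotone ⟨n, p'⟩ r m) {c : Fin n} (hc : m ≤ c.val)
    (agree : ∀ k < c, p k = p' k) : ¬ r (p c).val (p' c).val := by
  intro hr
  have hj : m ≤ (p'.symm (p c)).val := by
    by_contra h
    rw [not_le, ← hV] at h
    simp at h; omega
  rcases lt_trichotomy c (p'.symm (p c)) with h | h | h
  · have := hp' c _ hc h
    simp at this
    exact irrefl _ (_root_.trans hr this)
  · have : p' c = p c := (p'.symm_apply_eq.1 h.symm).symm
    rw [this] at hr
    exact irrefl _ hr
  · have := agree _ h
    simp at this
    rw [this] at h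
    simp at h

lemma eq_of_leftHeight_eq_of_gapCount_eq {π π' : FinitePerm} {r : ℕ → ℕ → Prop}
    [IsStrictTotalOrder ℕ r] {m : ℕ} (h : π.Gridding r m) (h' : π'.Gridding r m)
    (hH : ∀ c ≤ m, π.leftHeight m c = π'.leftHeight m c)
    (hG : ∀ g ≤ m, π.gapCount m g = π'.gapCount m g) : π = π' := by
  have hsize : π.size = π'.size := by
    rw [size_eq h.1, size_eq h'.1]
    congr 1
    exact sum_congr rfl fun g hg => hG g (by simp at hg; omega)
  have him : ((univ.filter fun i : Fin π.size => i.val < m).image fun i => (π.2 i).val) =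
      ((univ.filter fun i : Fin π'.size => i.val < m).image fun i => (π'.2 i).val) := by
    rw [image_left h.1, image_left h'.1]
    refine image_congr fun t ht => ?_
    simp only [coe_range, Set.mem_Iio] at ht
    congr 1
    exact sum_congr rfl fun g hg => hG g (by simp at hg; omega)
  obtain ⟨n, p⟩ := π
  obtain ⟨n', p'⟩ := π'
  change n = n' at hsize
  subst hsize
  congr 1
  have hV : (univ.filter fun i : Fin n => i.val < m).image p =
      (univ.filter fun i : Fin n => i.val < m).image p' := by
    apply image_injective Fin.val_injective
    rw [image_image, image_image]
    exact him
  have hV' : ∀ x, (p.symm x).val < m ↔ (p'.symm x).val < m := fun x => by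
    have := congrArg (x ∈ ·) hV
    simp only [mem_image, mem_filter_univ, eq_iff_iff] at this
    simpa [← Equiv.eq_symm_apply] using this
  ext1 c
  induction c using WellFoundedLT.induction with
  | _ c ih =>
    rcases lt_or_ge c.val m with hc | hc
    · exact le_antisymm
        (not_lt.1 (not_lt_of_leftHeight_eq hV.symm h'.2.1 hc (hH _ hc).symm
          fun k hk => (ih k hk).symm))
        (not_lt.1 (not_lt_of_leftHeight_eq hV h.2.1 hc (hH _ hc) ih))
    · apply Fin.ext
      rcases trichotomous_of r (p c).val (p' c).val with h1 | h1 | h1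
      · exact absurd h1 (not_rel_of_rightMonotone hV' h'.2.2 hc ih)
      · exact h1
      · exact absurd h1 (not_rel_of_rightMonotone (fun x => (hV' x).symm) h.2.2 hc
          fun k hk => (ih k hk).symm)

/-! ### Recognising the rightmost gridline -/

lemma Gridding.of_le_of_le {π : FinitePerm} {r : ℕ → ℕ → Prop} {m m' k : ℕ}
    (h : π.Gridding r m) (h' : π.Gridding r m') (hk : m ≤ k) (hk' : k ≤ m') :
    π.Gridding r k :=
  ⟨hk'.trans h'.1, fun a b c hab hbc hc => h'.2.1 a b c hab hbc (hc.trans_le hk'),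
    fun a b ha => h.2.2 a b (hk.trans ha)⟩

/-- A set of `k` positions that is an initial segment consists of the first `k` positions. -/
lemma eq_filter_val_lt_card {n : ℕ} {S : Finset (Fin n)}
    (hS : ∀ a b : Fin n, a < b → b ∈ S → a ∈ S) : S = univ.filter fun j => j.val < S.card := by
  have hle : S.card ≤ n := by simpa using card_le_univ S
  refine eq_of_subset_of_card_le (fun b hb => ?_) (card_filter_val_lt hle).le
  rw [mem_filter_univ]
  have : Iic b ⊆ S := fun a ha => by
    rcases (mem_Iic.1 ha).lt_or_eq with h | rfl
    · exact hS a b h hb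
    · exact hb
  have := card_le_card this
  rw [Fin.card_Iic] at this
  omega

/-- The first point right of a gridline completes a `312` exactly if the path of the points on the
left is strictly above the diagonal in the row of that point. -/
lemma leftHeight_leftRank_eq_iff {π : FinitePerm} {m : ℕ} (hm : m ≤ π.size) {x : Fin π.size}
    (hx : ∀ j : Fin π.size, j.val < m → π.2 j ≠ x) :
    π.leftHeight m (π.leftRank m x) = π.leftRank m x ↔
      ∀ a b : Fin π.size, a < b → b.val < m → π.2 b < x → ¬ x < π.2 a := by
  set S := univ.filter fun j : Fin π.size => j.val < m ∧ π.2 j < x with hS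
  have hSm : S.card ≤ m := leftRank_le hm x
  change π.leftHeight m S.card = S.card ↔ _
  set T := univ.filter fun j : Fin π.size =>
    j.val < m ∧ ∃ k : Fin π.size, k.val < S.card ∧ π.2 j ≤ π.2 k with hT
  change T.card = S.card ↔ _
  constructor
  · intro h a b hab hb hbx hxa
    have hT' : (univ.filter fun j : Fin π.size => j.val < S.card) = T :=
      eq_of_subset_of_card_le (fun j hj => by
        rw [mem_filter_univ] at hj
        exact (mem_filter_univ _).2 ⟨by omega, j, hj, le_rfl⟩)
        (by rw [card_filter_val_lt (hSm.trans hm), h])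
    -- Both sets are closed downwards in value among the left points, so one contains the other, and
    -- their cardinalities agree.
    have hST : S = T := by
      by_cases hs : S ⊆ T
      · exact eq_of_subset_of_card_le hs h.le
      · obtain ⟨i, hi, hiT⟩ := not_subset.1 hs
        refine (eq_of_subset_of_card_le (fun j hj => ?_) h.ge).symm
        rw [hS, mem_filter_univ] at hi ⊢
        rw [hT, mem_filter_univ] at hj hiT
        push Not at hiT
        obtain ⟨hj, k, hk, hjk⟩ := hj
        exact ⟨hj, hjk.trans_lt ((hiT hi.1 k hk).trans hi.2)⟩
    have hbS : b ∈ S := (mem_filter_univ _).2 ⟨hb, hbx⟩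
    rw [hST, ← hT', mem_filter_univ] at hbS
    have haT : a ∈ T := by rw [← hT', mem_filter_univ]; omega
    rw [← hST, hS, mem_filter_univ] at haT
    exact lt_asymm haT.2 hxa
  · intro h
    have hS' := eq_filter_val_lt_card (S := S) fun a b hab hb => by
      rw [hS, mem_filter_univ] at hb ⊢
      have ha : a.val < m := by omega
      exact ⟨ha, lt_of_le_of_ne (not_lt.1 (h a b hab hb.1 hb.2)) (hx a ha)⟩
    congr 1
    ext j
    have key : ∀ k : Fin π.size, k.val < S.card ↔ k.val < m ∧ π.2 k < x := fun k => by
      have := congrArg (k ∈ ·) hS'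
      simp only [mem_filter_univ, eq_iff_iff] at this
      rw [← this, hS, mem_filter_univ]
    rw [hT, hS, mem_filter_univ, mem_filter_univ]
    constructor
    · rintro ⟨hj, k, hk, hjk⟩
      exact ⟨hj, hjk.trans_lt ((key k).1 hk).2⟩
    · intro hj
      exact ⟨hj.1, j, (key j).2 hj, le_rfl⟩

/-- Griddings form an interval, so only the gridline `m + 1` has to be excluded. By monotonicity the
first right point sits in the `r`-first nonempty gap, which must therefore not be a return to the
diagonal. The right-hand side is phrased so that it also covers an empty right part. -/
lemma isGreatest_gridding_iff {π : FinitePerm} {r : ℕ → ℕ → Prop} {m : ℕ}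
    (hr : r = (· < ·) ∨ r = (· > ·)) :
    IsGreatest {m | π.Gridding r m} m ↔ π.Gridding r m ∧
      ∀ g ≤ m, π.leftHeight m g = g → (∀ g' ≤ m, r g' g → π.gapCount m g' = 0) →
        π.gapCount m g = 0 := by
  refine and_congr_right fun hgrid => ?_
  simp only [Set.mem_ofPred_eq] at hgrid
  have hm := hgrid.1
  rcases hm.lt_or_eq with hlt | heq
  swap
  · refine ⟨fun _ g _ _ _ => ?_, fun _ k hk => hk.1.trans heq.ge⟩
    rw [gapCount_eq_zero_iff]
    intro j hj
    omega
  set i : Fin π.size := ⟨m, hlt⟩ with hi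
  have hx : ∀ j : Fin π.size, j.val < m → π.2 j ≠ π.2 i := fun j hj e => by
    have := π.2.injective e
    rw [this] at hj
    simp [hi] at hj
  have hmono : ∀ j : Fin π.size, m ≤ j.val → j ≠ i → r (π.2 i).val (π.2 j).val := fun j hj hne =>
    hgrid.2.2 i j le_rfl (by
      rw [Fin.lt_def]; simp only [hi, Fin.ext_iff, ne_eq] at hne ⊢; omega)
  set g₀ := π.leftRank m (π.2 i) with hg₀
  have hg₀0 : π.gapCount m g₀ ≠ 0 := by
    rw [Ne, gapCount_eq_zero_iff]
    push Not
    exact ⟨i, le_rfl, rfl⟩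
  -- No right point lies in a gap that `r` places before the gap of the first right point.
  have hbefore : ∀ g, r g g₀ → π.gapCount m g = 0 := fun g hg => by
    rw [gapCount_eq_zero_iff]
    rintro j hj rfl
    by_cases hji : j = i
    · subst hji
      rcases hr with rfl | rfl <;> exact lt_irrefl _ hg
    have := hmono j hj hji
    rcases hr with rfl | rfl
    · exact (leftRank_mono π m (show π.2 i ≤ π.2 j from this.le)).not_gt hg
    · exact (leftRank_mono π m (show π.2 j ≤ π.2 i from this.le)).not_gt hg
  have step : (∀ k, π.Gridding r k → k ≤ m) ↔ π.leftHeight m g₀ ≠ g₀ := by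
    rw [Ne, hg₀, leftHeight_leftRank_eq_iff hm hx]
    constructor
    · intro h hab
      have : π.Gridding r (m + 1) := by
        refine ⟨hlt, fun a b c hab' hbc hc h1 h2 => ?_,
          fun a b ha => hgrid.2.2 a b (by omega)⟩
        rcases (Nat.lt_succ_iff.1 hc).lt_or_eq with hc | hc
        · exact hgrid.2.1 a b c hab' hbc hc h1 h2
        · obtain rfl : c = i := Fin.ext hc
          exact hab a b hab' hbc h1 h2
      have := h _ this
      omega
    · intro h k hk
      by_contra! hlt'
      have hk' := hgrid.of_le_of_le hk (by omega : m ≤ m + 1) hlt'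
      exact h fun a b hab hb h1 h2 => hk'.2.1 a b i hab hb (by simp [hi]) h1 h2
  change (∀ k, π.Gridding r k → k ≤ m) ↔ _
  rw [step]
  constructor
  · intro h g hg hgH hz
    by_contra h0
    rcases lt_trichotomy g g₀ with hlt | rfl | hlt
    · rcases hr with rfl | rfl
      · exact h0 (hbefore g hlt)
      · exact hg₀0 (hz g₀ (leftRank_le hm _) hlt)
    · exact h hgH
    · rcases hr with rfl | rfl
      · exact hg₀0 (hz g₀ (leftRank_le hm _) hlt)
      · exact h0 (hbefore g hlt)
  · intro h hgH
    exact hg₀0 (h g₀ (leftRank_le hm _) hgH fun g' _ hg' => hbefore g' hg')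

/-! ### Realising every path and every choice of gap counts -/

/-- The sequence that always takes the greatest unused value below the height of its column. -/
lemma exists_greedy (H : ℕ → ℕ) (m : ℕ) (hH : ∀ c < m, c < H (c + 1)) :
    ∃ f : ℕ → ℕ, ∀ i < m, f i < H (i + 1) ∧ (∀ j < i, f j ≠ f i) ∧
      ∀ v < H (i + 1), (∀ j < i, f j ≠ v) → v ≤ f i := by
  induction m with
  | zero => exact ⟨id, by simp⟩
  | succ m ih =>
    obtain ⟨f, hf⟩ := ih fun c hc => hH c (by omega)
    -- At most `m` values are used so far, while more than `m` are allowed in this column.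
    have hne : (range (H (m + 1)) \ (range m).image f).Nonempty := by
      rw [← card_pos]
      have := le_card_sdiff ((range m).image f) (range (H (m + 1)))
      have h1 : ((range m).image f).card ≤ m := card_image_le.trans (by simp)
      have := hH m (by omega)
      simp only [card_range] at *
      omega
    set w := max' _ hne with hw
    have hwm := max'_mem _ hne
    rw [← hw] at hwm
    simp only [mem_sdiff, mem_range, mem_image, not_exists, not_and] at hwm
    have hlt : ∀ i < m, Function.update f m w i = f i := fun i hi =>
      Function.update_of_ne hi.ne _ _
    refine ⟨Function.update f m w, fun i hi => ?_⟩
    rcases (Nat.lt_succ_iff.1 hi).lt_or_eq with hi | rfl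
    · rw [hlt i hi]
      refine ⟨(hf i hi).1, fun j hj => ?_, fun v hv hj => (hf i hi).2.2 v hv fun j hji => ?_⟩
      · rw [hlt j (hj.trans hi)]
        exact (hf i hi).2.1 j hj
      · rw [← hlt j (hji.trans hi)]
        exact hj j hji
    · rw [Function.update_self]
      refine ⟨hwm.1, fun j hj => ?_, fun v hv hj => le_max' _ _ ?_⟩
      · rw [hlt j hj]
        exact hwm.2 j hj
      · simp only [mem_sdiff, mem_range, mem_image, not_exists, not_and]
        refine ⟨hv, fun j hj' => ?_⟩
        rw [← hlt j hj']
        exact hj j hj'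

/-- The heights of a Dyck path of semilength `m`: `H c` is the number of up steps before the
right step number `c + 1`. -/
structure IsHeight (H : ℕ → ℕ) (m : ℕ) : Prop where
  zero : H 0 = 0
  mono : ∀ c < m, H c ≤ H (c + 1)
  le : ∀ c ≤ m, c ≤ H c
  self : H m = m

lemma IsHeight.monotone {H : ℕ → ℕ} {m : ℕ} (h : IsHeight H m) {a b : ℕ} (hab : a ≤ b)
    (hb : b ≤ m) : H a ≤ H b := by
  induction b, hab using Nat.le_induction with
  | base => rfl
  | succ b _ ih => exact (ih (by omega)).trans (h.mono b (by omega))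

lemma isHeight_leftHeight {π : FinitePerm} {m : ℕ} (hm : m ≤ π.size) :
    IsHeight (π.leftHeight m) m :=
  ⟨π.leftHeight_zero m, fun _ _ => π.leftHeight_mono m (by omega), fun _ => le_leftHeight hm,
    leftHeight_self hm⟩

/-- Every Dyck path is the path of a `312`-avoider. -/
lemma exists_perm_of_isHeight {H : ℕ → ℕ} {m : ℕ} (hH : IsHeight H m) :
    ∃ σ : Equiv.Perm (Fin m),
      (∀ a b c : Fin m, a < b → b < c → σ b < σ c → ¬ σ c < σ a) ∧
      ∀ c ≤ m, ∀ v : Fin m, (∃ k : Fin m, k.val < c ∧ v ≤ σ k) ↔ v.val < H c := by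
  obtain ⟨f, hf⟩ := exists_greedy H m fun c hc => hH.le (c + 1) hc
  have hfm : ∀ i < m, f i < m := fun i hi =>
    (hf i hi).1.trans_le ((hH.monotone (show i + 1 ≤ m from hi) le_rfl).trans_eq hH.self)
  have hinj : Function.Injective fun i : Fin m => (⟨f i, hfm i i.2⟩ : Fin m) := by
    intro i j hij
    simp only [Fin.mk.injEq] at hij
    by_contra hne
    rcases lt_or_gt_of_ne hne with h | h
    · exact (hf j j.2).2.1 i h hij
    · exact (hf i i.2).2.1 j h hij.symm
  refine ⟨Equiv.ofBijective _ (Finite.injective_iff_bijective.1 hinj), ?_, ?_⟩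
  · intro a b c hab hbc h1 h2
    -- In a `312` at `a`, `b`, `c`, the value at `c` was still unused and allowed at `b`, so the
    -- greedy choice at `b` would not be smaller.
    simp only [Equiv.ofBijective_apply, Fin.mk_lt_mk] at h1 h2
    refine h1.not_ge ((hf b b.2).2.2 _ (h2.trans ((hf a a.2).1.trans_le
      (hH.monotone (by omega) (by omega)))) fun j hj => (hf c c.2).2.1 j (by omega))
  · intro c
    induction c with
    | zero => intro _ v; simp [hH.zero]
    | succ c ih =>
      intro hc v
      specialize ih (by omega) v
      constructor
      · rintro ⟨k, hk, hv⟩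
        rcases (Nat.lt_succ_iff.1 hk).lt_or_eq with hk | rfl
        · exact (ih.1 ⟨k, hk, hv⟩).trans_le (hH.mono _ hc)
        · exact lt_of_le_of_lt hv (hf k k.2).1
      · intro hv
        by_cases hv' : v.val < H c
        · obtain ⟨k, hk, h⟩ := ih.2 hv'
          exact ⟨k, by omega, h⟩
        -- Values from `H c` upwards are unused before column `c`, so the greedy choice there is at
        -- least `v`.
        · refine ⟨⟨c, hc⟩, by simp, ?_⟩
          refine (hf c hc).2.2 v hv fun j hj e => ?_
          have := (hf j (by omega)).1
          have := hH.monotone (show j + 1 ≤ c from hj) (by omega)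
          omega

/-- The left value of rank `t` is placed above all right points of gaps `0, …, t`, which prescribes
its value. The remaining values are put on the right in `r`-order. -/
lemma exists_gridding {H G : ℕ → ℕ} {m : ℕ} (hH : IsHeight H m) {r : ℕ → ℕ → Prop}
    (hr : r = (· < ·) ∨ r = (· > ·)) :
    ∃ π : FinitePerm, π.Gridding r m ∧ (∀ c ≤ m, π.leftHeight m c = H c) ∧
      ∀ g ≤ m, π.gapCount m g = G g := by
  obtain ⟨σ, hσ, hσH⟩ := exists_perm_of_isHeight hH
  set k := ∑ g ∈ range (m + 1), G g with hk
  have hmono : ∀ G : ℕ → ℕ, StrictMono fun t => t + ∑ g ∈ range (t + 1), G g := fun G =>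
    strictMono_nat_of_lt_succ fun t => by
      rw [sum_range_succ _ (t + 1)]; omega
  let e : Fin m ↪o Fin (m + k) := OrderEmbedding.ofStrictMono
    (fun i => ⟨i + ∑ g ∈ range (i + 1), G g, by
      have : ∑ g ∈ range (i + 1), G g ≤ k :=
        sum_le_sum_of_subset (range_subset_range.2 (by omega))
      omega⟩) fun i j h => hmono G h
  set V : Finset (Fin (m + k)) := univ.map e.toEmbedding with hV
  have hVm : V.card = m := by simp [hV]
  have hVk : Vᶜ.card = k := by rw [card_compl, hVm]; simp
  obtain ⟨τ, hτ⟩ : ∃ τ : Equiv.Perm (Fin k), ∀ a b, a < b →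
      r (Vᶜ.orderEmbOfFin hVk (τ a)).val (Vᶜ.orderEmbOfFin hVk (τ b)).val := by
    rcases hr with rfl | rfl
    · exact ⟨Equiv.refl _, fun a b h => by simpa using h⟩
    · exact ⟨Fin.revPerm, fun a b h => by simpa using h⟩
  let p : Equiv.Perm (Fin (m + k)) := finSumFinEquiv.symm.trans
    ((Equiv.sumCongr σ τ).trans (finSumEquivOfFinset hVm hVk))
  have hpl : ∀ i, p (Fin.castAdd k i) = e (σ i) := fun i => by
    have : V.orderEmbOfFin hVm = e := (orderEmbOfFin_unique' hVm fun x => by simp [hV]).symm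
    simp [p, this]
  have hpr : ∀ i, p (Fin.natAdd m i) = Vᶜ.orderEmbOfFin hVk (τ i) := fun i => by
    simp [p]
  have hleft : ∀ i : Fin (m + k), i.val < m → ∃ j, i = Fin.castAdd k j := fun i hi =>
    ⟨⟨i, hi⟩, rfl⟩
  have hright : ∀ i : Fin (m + k), m ≤ i.val → ∃ j, i = Fin.natAdd m j := fun i hi =>
    ⟨⟨i - m, by omega⟩, by ext; simp; omega⟩
  have hm : m ≤ size ⟨m + k, p⟩ := Nat.le_add_right m k
  refine ⟨⟨m + k, p⟩, ⟨hm, ?_, ?_⟩, ?_, ?_⟩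
  · intro a b c hab hbc hc
    obtain ⟨a, rfl⟩ := hleft a (by omega)
    obtain ⟨b, rfl⟩ := hleft b (by omega)
    obtain ⟨c, rfl⟩ := hleft c hc
    dsimp only
    rw [hpl, hpl, hpl, e.lt_iff_lt, e.lt_iff_lt]
    exact hσ a b c hab hbc
  · intro a b ha hab
    obtain ⟨b, rfl⟩ := hright b (by omega)
    obtain ⟨a, rfl⟩ := hright a ha
    dsimp only
    rw [hpr, hpr]
    exact hτ a b (Nat.lt_of_add_lt_add_left (n := m) hab)
  · intro c hc
    have hcm : H c ≤ m := (hH.monotone hc le_rfl).trans_eq hH.self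
    rw [← card_filter_val_lt hcm, ← card_map (σ.symm.toEmbedding.trans (Fin.castAddEmb k)),
      leftHeight]
    congr 1
    ext j
    simp only [mem_filter_univ, mem_map]
    constructor
    · rintro ⟨hj, i, hi, hji⟩
      obtain ⟨j, rfl⟩ := hleft j hj
      obtain ⟨i, rfl⟩ := hleft i (by omega)
      rw [hpl, hpl, e.le_iff_le] at hji
      exact ⟨σ j, (hσH c hc _).1 ⟨i, hi, hji⟩, by simp⟩
    · rintro ⟨v, hv, rfl⟩
      obtain ⟨i, hi, hvi⟩ := (hσH c hc _).2 hv
      refine ⟨by simp, Fin.castAdd k i, hi, ?_⟩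
      simp only [Function.Embedding.trans_apply, Equiv.coe_toEmbedding, Fin.castAddEmb_apply]
      rw [hpl, hpl, σ.apply_symm_apply]
      exact e.monotone hvi
  · have him := image_left hm
    have him' : ((univ.filter fun i : Fin (m + k) => i.val < m).image fun i => (p i).val) =
        (range m).image fun t => t + ∑ g ∈ range (t + 1), G g := by
      ext x
      simp only [mem_image, mem_filter_univ, mem_range]
      constructor
      · rintro ⟨i, hi, rfl⟩
        obtain ⟨i, rfl⟩ := hleft i hi
        exact ⟨σ i, (σ i).2, by rw [hpl]; rfl⟩
      · rintro ⟨t, ht, rfl⟩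
        exact ⟨Fin.castAdd k (σ.symm ⟨t, ht⟩), by simp, by rw [hpl, σ.apply_symm_apply]; rfl⟩
    -- A strictly increasing sequence is determined by its range, so the left values give the
    -- partial sums up to gap `m - 1`. The last partial sum comes from the total size.
    have hsum : ∀ t ≤ m + 1, ∑ g ∈ range t, gapCount ⟨m + k, p⟩ m g = ∑ g ∈ range t, G g := by
      have hrange := him.symm.trans him'
      have := (StrictMono.range_inj ((hmono (gapCount ⟨m + k, p⟩ m)).comp Fin.val_strictMono)
        ((hmono G).comp (Fin.val_strictMono (n := m)))).1 (by
          have := congrArg (fun s : Finset ℕ => (s : Set ℕ)) hrange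
          simpa [Set.range_comp, Fin.range_val] using this)
      intro t ht
      rcases ht.lt_or_eq with ht | rfl
      · rcases t with _ | t
        · simp
        · have := congrFun this ⟨t, by omega⟩
          simp only [Function.comp_apply] at this
          omega
      · have := size_eq hm
        change m + k = _ at this
        omega
    intro g hg
    have h1 := hsum g (by omega)
    have h2 := hsum (g + 1) (by omega)
    rw [sum_range_succ, sum_range_succ] at h2
    omega

end FinitePerm

/-! ### Dyck words as height functions -/

section Columns

open DyckStep List

/-- The lattice path with `k` up steps right before its `c`-th right step, where `k` is the `c`-th
entry of the given list. -/
def columns (a : List ℕ) : List DyckStep :=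
  a.flatMap fun k => replicate k U ++ [D]

@[simp] lemma columns_nil : columns [] = [] := rfl

lemma columns_cons (k : ℕ) (a : List ℕ) :
    columns (k :: a) = replicate k U ++ D :: columns a := by
  simp [columns]

lemma columns_append (a b : List ℕ) : columns (a ++ b) = columns a ++ columns b := by
  simp [columns]

lemma count_U_columns (a : List ℕ) : (columns a).count U = a.sum := by
  induction a with
  | nil => rfl
  | cons k a ih => simp [columns_cons, count_append, ih]

lemma count_D_columns (a : List ℕ) : (columns a).count D = a.length := by
  induction a with
  | nil => rfl
  | cons k a ih => simp [columns_cons, count_append, ih, count_replicate]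

lemma columns_injective : Function.Injective columns := by
  have key : ∀ (k l : ℕ) (x y : List DyckStep),
      replicate k U ++ D :: x = replicate l U ++ D :: y → k = l ∧ x = y := by
    intro k
    induction k with
    | zero =>
      rintro (_ | l) x y h
      · simpa using h
      · simp [replicate_succ] at h
    | succ k ih =>
      rintro (_ | l) x y h
      · simp [replicate_succ] at h
      · simpa using ih l x y (by simpa [replicate_succ] using h)
  intro a
  induction a with
  | nil =>
    rintro (_ | ⟨l, b⟩) h
    · rfl
    · simp [columns_cons] at h
  | cons k a ih =>
    rintro (_ | ⟨l, b⟩) h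
    · simp [columns_cons] at h
    · rw [columns_cons, columns_cons] at h
      obtain ⟨rfl, hab⟩ := key _ _ _ _ h
      rw [ih hab]

lemma exists_columns_append_replicate (w : List DyckStep) :
    ∃ a k, w = columns a ++ replicate k U := by
  induction w with
  | nil => exact ⟨[], 0, rfl⟩
  | cons s w ih =>
    obtain ⟨a, k, rfl⟩ := ih
    rcases s.dichotomy with rfl | rfl
    · cases a with
      | nil => exact ⟨[], k + 1, rfl⟩
      | cons x a => exact ⟨(x + 1) :: a, k, by simp [columns_cons, replicate_succ]⟩
    · exact ⟨0 :: a, k, by simp [columns_cons]⟩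

/-- Trailing up steps are impossible: the path is weakly above the diagonal before them and on it
after them. -/
lemma DyckWord.exists_columns (w : DyckWord) : ∃ a, w.toList = columns a := by
  obtain ⟨a, k, h⟩ := exists_columns_append_replicate w.toList
  have h1 := w.count_D_le_count_U (columns a).length
  have h2 := w.count_U_eq_count_D
  rw [h, take_left, count_D_columns, count_U_columns] at h1
  rw [h, count_append, count_append, count_D_columns, count_U_columns, count_replicate,
    count_replicate] at h2
  simp at h2
  obtain rfl : k = 0 := by omega
  exact ⟨a, by simpa using h⟩

/-- The Dyck inequality needs checking only at the start and after right steps. The offsets `s` and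
`d` count the up and right steps already consumed by the induction. -/
lemma count_take_columns (a : List ℕ) (s d i : ℕ)
    (h : ∀ j ≤ a.length, d + j ≤ s + (a.take j).sum) :
    d + ((columns a).take i).count D ≤ s + ((columns a).take i).count U := by
  induction a generalizing s d i with
  | nil => simpa using h 0
  | cons k a ih =>
    rw [columns_cons]
    rcases le_or_gt i k with hi | hi
    · have h0 := h 0 (by simp)
      rw [take_append_of_le_length (by simpa using hi), take_replicate]
      simp [count_replicate] at h0 ⊢
      omega
    · obtain ⟨i, rfl⟩ := Nat.exists_eq_add_of_lt hi
      have := ih (s + k) (d + 1) i fun j hj => by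
        have := h (j + 1) (by simpa using hj)
        simp at this
        omega
      rw [take_append, show k + i + 1 - (replicate k U).length = i + 1 by simp; omega,
        take_of_length_le (by simp; omega), take_succ_cons]
      simp [count_append, count_replicate]
      omega

/-- The increments of the first `m` steps of a sequence. -/
def increments (H : ℕ → ℕ) (m : ℕ) : List ℕ := (range m).map fun c => H (c + 1) - H c

@[simp] lemma length_increments (H : ℕ → ℕ) (m : ℕ) : (increments H m).length = m := by
  simp [increments]

lemma take_increments (H : ℕ → ℕ) {m g : ℕ} (hg : g ≤ m) :
    (increments H m).take g = increments H g := by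
  rw [increments, ← map_take, take_range, min_eq_left hg, increments]

open FinitePerm

lemma FinitePerm.leftPath_eq (π : FinitePerm) (m : ℕ) :
    π.leftPath m = columns (increments (π.leftHeight m) m) := by
  rw [leftPath, columns, increments, flatMap_map]

lemma FinitePerm.IsHeight.sum_increments {H : ℕ → ℕ} {m : ℕ} (h : IsHeight H m) {c : ℕ}
    (hc : c ≤ m) : (increments H c).sum = H c := by
  induction c with
  | zero => simp [increments, h.zero]
  | succ c ih =>
    have := h.mono c hc
    rw [increments, range_succ, map_append, sum_append, ← increments, ih (by omega)]
    simp
    omega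

/-- The Dyck path with the given heights. -/
def FinitePerm.IsHeight.toDyckWord {H : ℕ → ℕ} {m : ℕ} (h : IsHeight H m) : DyckWord where
  toList := columns (increments H m)
  count_U_eq_count_D := by
    rw [count_U_columns, count_D_columns, h.sum_increments le_rfl, h.self, length_increments]
  count_D_le_count_U i := by
    simpa using count_take_columns (increments H m) 0 0 i fun j hj => by
      rw [length_increments] at hj
      rw [take_increments _ hj, h.sum_increments hj]
      simpa using h.le j hj

lemma FinitePerm.IsHeight.semilength_toDyckWord {H : ℕ → ℕ} {m : ℕ} (h : IsHeight H m) :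
    h.toDyckWord.semilength = m := by
  rw [DyckWord.semilength_eq_count_D, toDyckWord, count_D_columns, length_increments]

lemma DyckWord.exists_isHeight (w : DyckWord) :
    ∃ H, ∃ h : IsHeight H w.semilength, w = h.toDyckWord := by
  obtain ⟨a, ha⟩ := w.exists_columns
  have hlen : w.semilength = a.length := by
    rw [DyckWord.semilength_eq_count_D, ha, count_D_columns]
  have hsum : w.semilength = a.sum := by
    rw [DyckWord.semilength, ha, count_U_columns]
  -- The height over a column is the number of up steps in the columns so far.
  have hH : IsHeight (fun c => (a.take c).sum) w.semilength := by
    refine ⟨by simp, fun c hc => ?_, fun c hc => ?_, ?_⟩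
    · rw [sum_take_succ _ _ (hlen ▸ hc)]
      omega
    · have := w.count_D_le_count_U (columns (a.take c)).length
      have e : columns a = columns (a.take c) ++ columns (a.drop c) := by
        rw [← columns_append, take_append_drop]
      rw [ha, e, take_left, count_D_columns, count_U_columns, length_take] at this
      omega
    · rw [hlen, take_length, ← hsum, hlen]
  refine ⟨_, hH, DyckWord.ext (ha.trans (congrArg columns ?_))⟩
  refine ext_getElem (by simp [hlen]) fun i h1 h2 => ?_
  simp [increments, sum_take_succ _ _ h1]

lemma FinitePerm.IsHeight.eq_iff_exists_add {H : ℕ → ℕ} {m : ℕ} (h : IsHeight H m) {g : ℕ}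
    (hg : g ≤ m) : H g = g ↔ ∃ a b, h.toDyckWord = a + b ∧ a.semilength = g := by
  constructor
  · intro hH
    have ha : IsHeight H g :=
      ⟨h.zero, fun c hc => h.mono c (by omega), fun c hc => h.le c (by omega), hH⟩
    have hb : IsHeight (fun c => H (g + c) - g) (m - g) := by
      refine ⟨by simp [hH], fun c hc => ?_, fun c hc => ?_, ?_⟩
      · have := h.mono (g + c) (by omega)
        rw [← add_assoc]
        omega
      · have := h.le (g + c) (by omega)
        omega
      · rw [show g + (m - g) = m by omega, h.self]
    refine ⟨ha.toDyckWord, hb.toDyckWord, ?_, ha.semilength_toDyckWord⟩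
    ext1
    change columns _ = columns _ ++ columns _
    rw [← columns_append]
    congr 1
    obtain ⟨k, rfl⟩ := Nat.exists_eq_add_of_le hg
    rw [increments, increments, increments, range_add, map_append, map_map]
    congr 1
    rw [show g + k - g = k by omega]
    refine map_congr_left fun c hc => ?_
    have := h.le (g + c) (by simp at hc; omega)
    simp only [Function.comp_apply]
    rw [add_assoc]
    omega
  · rintro ⟨a, b, hab, ha⟩
    obtain ⟨A, hA⟩ := a.exists_columns
    obtain ⟨B, hB⟩ := b.exists_columns
    have h1 : columns (increments H m) = columns (A ++ B) := by
      rw [columns_append, ← hA, ← hB]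
      exact congrArg DyckWord.toList hab
    have h2 : A.length = g := by
      rw [← ha, DyckWord.semilength_eq_count_D, hA, count_D_columns]
    have h3 : A.sum = g := by rw [← ha, DyckWord.semilength, hA, count_U_columns]
    have := congrArg (List.take g) (columns_injective h1)
    rw [take_increments _ hg, take_left' h2] at this
    rw [← h.sum_increments hg, this, h3]

end Columns

/-! ### Decomposition into excursions -/

section Excursions

lemma DyckWord.IsNested.exists_nest {w : DyckWord} (h : w.IsNested) :
    ∃ p : DyckWord, w = p.nest := ⟨w.denest h, (w.nest_denest h).symm⟩

lemma DyckWord.exists_sum_isNested (w : DyckWord) :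
    ∃ L : List DyckWord, (∀ e ∈ L, e.IsNested) ∧ L.sum = w := by
  induction hn : w.semilength using Nat.strong_induction_on generalizing w with
  | _ n ih =>
    by_cases h : w = 0
    · exact ⟨[], by simp, by simp [h]⟩
    · obtain ⟨L, hL, hw⟩ := ih _ (hn ▸ semilength_outsidePart_lt h) w.outsidePart rfl
      refine ⟨w.insidePart.nest :: L, ?_, ?_⟩
      · rintro e he
        rcases List.mem_cons.1 he with rfl | he
        · exact DyckWord.IsNested.nest
        · exact hL e he
      · rw [List.sum_cons, hw, nest_insidePart_add_outsidePart h]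

lemma DyckWord.nest_add_ne_zero (p q : DyckWord) : p.nest + q ≠ 0 := by
  intro h
  have := congrArg semilength h
  simp at this

/-- The labels of the up steps of a sequence of excursions, in order. -/
def labels (L : List DecoratedPath) : List ℕ := (L.map Prod.snd).flatten

@[simp] lemma labels_nil : labels [] = [] := rfl

@[simp] lemma labels_cons (e : DecoratedPath) (L : List DecoratedPath) :
    labels (e :: L) = e.2 ++ labels L := by simp [labels]

@[simp] lemma labels_append (A B : List DecoratedPath) :
    labels (A ++ B) = labels A ++ labels B := by simp [labels]

/-- A sequence of excursions, each with one label for each of its up steps. -/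
def IsExcursionList (L : List DecoratedPath) : Prop :=
  ∀ e ∈ L, e.1.IsNested ∧ e.2.length = e.1.semilength

lemma IsExcursionList.length_labels {L : List DecoratedPath} (h : IsExcursionList L) :
    (labels L).length = (L.map Prod.fst).sum.semilength := by
  induction L with
  | nil => simp
  | cons e L ih =>
    simp [ih fun e he => h e (by simp [he]), (h e (by simp)).2]

lemma IsExcursionList.append_iff {A B : List DecoratedPath} :
    IsExcursionList (A ++ B) ↔ IsExcursionList A ∧ IsExcursionList B := List.forall_mem_append

lemma isExcursionDecomposition_iff {w : DyckWord} {h : List ℕ} {L : List DecoratedPath} :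
    IsExcursionDecomposition w.toList h L ↔
      IsExcursionList L ∧ (L.map Prod.fst).sum = w ∧ labels L = h := by
  rw [IsExcursionDecomposition, ← DyckWord.ext_iff]
  rfl

lemma exists_isExcursionDecomposition {w : DyckWord} {h : List ℕ} (hl : h.length = w.semilength) :
    ∃ L, IsExcursionDecomposition w.toList h L := by
  simp only [isExcursionDecomposition_iff]
  obtain ⟨L, hL, rfl⟩ := w.exists_sum_isNested
  induction L generalizing h with
  | nil =>
    obtain rfl : h = [] := by simpa using hl
    exact ⟨[], by simp [IsExcursionList]⟩
  | cons e L ih =>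
    simp only [List.sum_cons, DyckWord.semilength_add] at hl
    obtain ⟨M, hM, hM1, hM2⟩ := ih (h := h.drop e.semilength) (fun x hx => hL x (by simp [hx]))
      (by rw [List.length_drop]; omega)
    refine ⟨(e, h.take e.semilength) :: M, ?_, by simp [hM1], by simp [hM2]⟩
    rintro x hx
    rcases List.mem_cons.1 hx with rfl | hx
    · exact ⟨hL _ (by simp), by simp; omega⟩
    · exact hM x hx

/-- The first-return decomposition recovers the first excursion and the remaining path. The
semilength of that excursion then tells where to cut the labels. -/
lemma IsExcursionList.eq_of_sum_eq {L L' : List DecoratedPath} (h : IsExcursionList L)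
    (h' : IsExcursionList L') (hs : (L.map Prod.fst).sum = (L'.map Prod.fst).sum)
    (hl : labels L = labels L') : L = L' := by
  induction L generalizing L' with
  | nil =>
    cases L' with
    | nil => rfl
    | cons e' L' =>
      obtain ⟨p, hp⟩ := (h' e' (by simp)).1.exists_nest
      simp only [List.map_nil, List.sum_nil, List.map_cons, List.sum_cons, hp] at hs
      exact absurd hs.symm (DyckWord.nest_add_ne_zero _ _)
  | cons e L ih =>
    obtain ⟨p, hp⟩ := (h e (by simp)).1.exists_nest
    cases L' with
    | nil =>
      simp only [List.map_nil, List.sum_nil, List.map_cons, List.sum_cons, hp] at hs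
      exact absurd hs (DyckWord.nest_add_ne_zero _ _)
    | cons e' L' =>
      obtain ⟨p', hp'⟩ := (h' e' (by simp)).1.exists_nest
      have he := (h e (by simp)).2
      have he' := (h' e' (by simp)).2
      obtain ⟨w, l⟩ := e
      obtain ⟨w', l'⟩ := e'
      dsimp only at hp hp' he he'
      subst hp hp'
      simp only [List.map_cons, List.sum_cons] at hs
      have h1 := congrArg DyckWord.insidePart hs
      have h2 := congrArg DyckWord.outsidePart hs
      rw [DyckWord.insidePart_add (DyckWord.nest_ne_zero), DyckWord.insidePart_nest,
        DyckWord.insidePart_add (DyckWord.nest_ne_zero), DyckWord.insidePart_nest] at h1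
      rw [DyckWord.outsidePart_add (DyckWord.nest_ne_zero), DyckWord.outsidePart_nest,
        DyckWord.outsidePart_add (DyckWord.nest_ne_zero), DyckWord.outsidePart_nest, zero_add,
        zero_add] at h2
      subst h1
      rw [labels_cons, labels_cons] at hl
      obtain ⟨rfl, hl'⟩ := List.append_inj hl (he.trans he'.symm)
      rw [ih (fun x hx => h x (by simp [hx])) (fun x hx => h' x (by simp [hx])) h2 hl']

/-- A factorisation of a Dyck path splits its sequence of excursions. -/
lemma IsExcursionList.exists_append {L : List DecoratedPath} (h : IsExcursionList L)
    {a b : DyckWord} (hs : (L.map Prod.fst).sum = a + b) :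
    ∃ A B, L = A ++ B ∧ (A.map Prod.fst).sum = a := by
  have hlen := h.length_labels
  rw [hs, DyckWord.semilength_add] at hlen
  obtain ⟨A, hA⟩ := exists_isExcursionDecomposition (w := a)
    (h := (labels L).take a.semilength) (by simp; omega)
  obtain ⟨B, hB⟩ := exists_isExcursionDecomposition (w := b)
    (h := (labels L).drop a.semilength) (by simp; omega)
  rw [isExcursionDecomposition_iff] at hA hB
  refine ⟨A, B, h.eq_of_sum_eq (IsExcursionList.append_iff.2 ⟨hA.1, hB.1⟩) ?_ ?_, hA.2.1⟩
  · rw [hs, List.map_append, List.sum_append, hA.2.1, hB.2.1]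
  · rw [labels_append, hA.2.2, hB.2.2, List.take_append_drop]

lemma FinitePerm.IsHeight.eq_iff_exists_append {H : ℕ → ℕ} {m : ℕ} (h : IsHeight H m)
    {L : List DecoratedPath} (hL : IsExcursionList L)
    (hs : (L.map Prod.fst).sum = h.toDyckWord) {g : ℕ} (hg : g ≤ m) :
    H g = g ↔ ∃ A B, L = A ++ B ∧ (labels A).length = g := by
  rw [h.eq_iff_exists_add hg]
  constructor
  · rintro ⟨a, b, hab, rfl⟩
    obtain ⟨A, B, rfl, hA⟩ := hL.exists_append (hs.trans hab)
    exact ⟨A, B, rfl, by rw [(IsExcursionList.append_iff.1 hL).1.length_labels, hA]⟩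
  · rintro ⟨A, B, rfl, rfl⟩
    exact ⟨_, _, by rw [← hs, List.map_append, List.sum_append],
      (IsExcursionList.append_iff.1 hL).1.length_labels.symm⟩

/-! ### Maximality of the gridline in terms of labels -/

/-- Whenever a nonzero label occurs up to some return to the diagonal, the first nonzero label is
not on the last up step before that return. -/
def ValidAbove (L : List DecoratedPath) : Prop :=
  ∀ A B, L = A ++ B → (∀ x ∈ (labels A).dropLast, x = 0) → ∀ x ∈ labels A, x = 0

/-- Whenever a nonzero label occurs after some return to the diagonal, the last nonzero label is
not on the first up step after that return. -/
def ValidBelow (L : List DecoratedPath) : Prop :=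
  ∀ A B, L = A ++ B → (∀ x ∈ (labels B).tail, x = 0) → ∀ x ∈ labels B, x = 0

/-- Labels are shifted by one: at a return `g > 0`, gap `g` is the last label before the return,
hence the `dropLast`. Gap `0` carries no label, but the start of the path is a return with no
earlier gap, so it must be empty. -/
lemma FinitePerm.IsHeight.validAbove_iff {H : ℕ → ℕ} {m : ℕ} (h : IsHeight H m)
    {L : List DecoratedPath} (hL : IsExcursionList L)
    (hs : (L.map Prod.fst).sum = h.toDyckWord) {G : ℕ → ℕ}
    (hG : labels L = (List.range m).map fun i => G (i + 1)) :
    (∀ g ≤ m, H g = g → (∀ g' ≤ m, g' < g → G g' = 0) → G g = 0) ↔ G 0 = 0 ∧ ValidAbove L := by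
  have key : ∀ A B, L = A ++ B → (labels A).length ≤ m ∧
      labels A = (List.range (labels A).length).map fun i => G (i + 1) := by
    rintro A B rfl
    rw [labels_append] at hG
    have hlen := congrArg List.length hG
    simp only [List.length_append, List.length_map, List.length_range] at hlen
    have := congrArg (List.take (labels A).length) hG
    rw [List.take_left, ← List.map_take, List.take_range, min_eq_left (by omega)] at this
    exact ⟨by omega, this⟩
  constructor
  · intro hc
    have h0 : G 0 = 0 := hc 0 (by omega) h.zero (by simp)
    refine ⟨h0, fun A B hAB hz => ?_⟩
    obtain ⟨hm, hA⟩ := key A B hAB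
    have hH := (h.eq_iff_exists_append hL hs hm).2 ⟨A, B, hAB, rfl⟩
    generalize (labels A).length = g at *
    rw [hA] at hz ⊢
    rcases g with _ | g
    · simp
    · rw [List.range_succ, List.map_append, List.map_singleton, List.dropLast_concat] at hz
      simp only [List.mem_map, List.mem_range, forall_exists_index, and_imp,
        forall_apply_eq_imp_iff₂] at hz ⊢
      have := hc (g + 1) hm hH fun g' _ hg' => by
        rcases g' with _ | g'
        · exact h0
        · exact hz g' (by omega)
      intro i hi
      rcases (Nat.lt_succ_iff.1 hi).lt_or_eq with hi | rfl
      · exact hz i hi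
      · exact this
  · rintro ⟨h0, hv⟩ g hg hH hz
    obtain ⟨A, B, hAB, hgA⟩ := (h.eq_iff_exists_append hL hs hg).1 hH
    obtain ⟨-, hA⟩ := key A B hAB
    have := hv A B hAB
    rw [hgA] at hA
    rw [hA] at this
    rcases g with _ | g
    · exact h0
    · rw [List.range_succ, List.map_append, List.map_singleton, List.dropLast_concat] at this
      refine this (fun x hx => ?_) _ (by simp)
      obtain ⟨i, hi, rfl⟩ := List.mem_map.1 hx
      rw [List.mem_range] at hi
      exact hz (i + 1) (by omega) (by omega)

/-- At a return `g < m`, gap `g` is the first label after the return, hence the `tail`. The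
unlabelled gap `m` must be empty because the end of the path is a return with no later gap. -/
lemma FinitePerm.IsHeight.validBelow_iff {H : ℕ → ℕ} {m : ℕ} (h : IsHeight H m)
    {L : List DecoratedPath} (hL : IsExcursionList L)
    (hs : (L.map Prod.fst).sum = h.toDyckWord) {G : ℕ → ℕ}
    (hG : labels L = (List.range m).map G) :
    (∀ g ≤ m, H g = g → (∀ g' ≤ m, g' > g → G g' = 0) → G g = 0) ↔ G m = 0 ∧ ValidBelow L := by
  have key : ∀ A B, L = A ++ B → ∃ k, (labels A).length + k = m ∧
      labels B = (List.range k).map fun i => G ((labels A).length + i) := by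
    rintro A B rfl
    rw [labels_append] at hG
    have hlen := congrArg List.length hG
    simp only [List.length_append, List.length_map, List.length_range] at hlen
    refine ⟨_, hlen, ?_⟩
    have := congrArg (List.drop (labels A).length) hG
    rw [List.drop_left, ← hlen, List.range_add, List.map_append,
      List.drop_left' (by simp), List.map_map] at this
    exact this
  constructor
  · intro hc
    have h0 : G m = 0 := hc m le_rfl h.self (by omega)
    refine ⟨h0, fun A B hAB hz => ?_⟩
    obtain ⟨k, hm, hB⟩ := key A B hAB
    have hH := (h.eq_iff_exists_append hL hs (by omega)).2 ⟨A, B, hAB, rfl⟩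
    generalize (labels A).length = g at *
    rw [hB] at hz ⊢
    rcases k with _ | k
    · simp
    · rw [List.range_succ_eq_map, List.map_cons, List.tail_cons] at hz
      simp only [List.mem_map, List.mem_range, forall_exists_index, and_imp,
        forall_apply_eq_imp_iff₂] at hz ⊢
      have hgt : ∀ g' ≤ m, g' > g → G g' = 0 := fun g' hg'm hg' => by
        rcases hg'm.lt_or_eq with hlt | rfl
        · have := hz (g' - g - 1) (by omega)
          rwa [show g + (g' - g - 1).succ = g' by omega] at this
        · exact h0
      intro i hi
      rcases i with _ | i
      · exact hc g (by omega) hH hgt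
      · exact hgt _ (by omega) (by omega)
  · rintro ⟨h0, hv⟩ g hg hH hz
    obtain ⟨A, B, hAB, rfl⟩ := (h.eq_iff_exists_append hL hs hg).1 hH
    obtain ⟨k, hm, hB⟩ := key A B hAB
    have := hv A B hAB
    rw [hB] at this
    rcases k with _ | k
    · rw [add_zero] at hm
      rwa [hm]
    · rw [List.range_succ_eq_map, List.map_cons, List.tail_cons] at this
      refine this (fun x hx => ?_) _ (by simp)
      simp only [List.mem_map, List.mem_range] at hx
      obtain ⟨i, ⟨j, hj, rfl⟩, rfl⟩ := hx
      exact hz _ (by omega) (by omega)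

end Excursions

/-! ### Reshuffling as a bijection between valid lists -/

section Reshuffle

lemma exists_first_nonzero (L : List DecoratedPath) :
    (∀ e ∈ L, ∀ x ∈ e.2, x = 0) ∨ ∃ A M B, L = A ++ M :: B ∧
      (∀ e ∈ A, ∀ x ∈ e.2, x = 0) ∧ ¬ ∀ x ∈ M.2, x = 0 := by
  induction L with
  | nil => simp
  | cons e L ih =>
    by_cases he : ∀ x ∈ e.2, x = 0
    · rcases ih with h | ⟨A, M, B, rfl, hA, hM⟩
      · exact Or.inl (List.forall_mem_cons.2 ⟨he, h⟩)
      · exact Or.inr ⟨e :: A, M, B, rfl, List.forall_mem_cons.2 ⟨he, hA⟩, hM⟩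
    · exact Or.inr ⟨[], e, L, rfl, by simp, he⟩

lemma reshuffle_of_zero {L : List DecoratedPath} (h : ∀ e ∈ L, ∀ x ∈ e.2, x = 0) :
    reshuffle L = L := by
  have h' : ∀ e ∈ L, (e.2.all (· == 0)) = true := by simpa using h
  have h1 : L.dropWhile (fun e => e.2.all (· == 0)) = [] := List.dropWhile_eq_nil_iff.2 h'
  have h2 : L.takeWhile (fun e => e.2.all (· == 0)) = L := List.takeWhile_eq_self_iff.2 h'
  rw [reshuffle, h1, h2]

lemma reshuffle_append_cons {A B : List DecoratedPath} {M : DecoratedPath}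
    (hA : ∀ e ∈ A, ∀ x ∈ e.2, x = 0) (hM : ¬ ∀ x ∈ M.2, x = 0) :
    reshuffle (A ++ M :: B) = B ++ (M.1, M.2.reverse) :: A := by
  have hA' : ∀ e ∈ A, (e.2.all (· == 0)) = true := by simpa using hA
  have hM' : ¬ (M.2.all (· == 0)) = true := by simpa using hM
  have h1 : (A ++ M :: B).dropWhile (fun e => e.2.all (· == 0)) = M :: B := by
    rw [List.dropWhile_append_of_pos hA', List.dropWhile_cons_of_neg
      (p := fun e : DecoratedPath => e.2.all (· == 0)) hM']
  have h2 : (A ++ M :: B).takeWhile (fun e => e.2.all (· == 0)) = A := by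
    rw [List.takeWhile_append_of_pos hA', List.takeWhile_cons_of_neg
      (p := fun e : DecoratedPath => e.2.all (· == 0)) hM', List.append_nil]
  rw [reshuffle, h1, h2]

/-- Reverse the order of the excursions and the labels of each of them. -/
def reverseLabels (L : List DecoratedPath) : List DecoratedPath :=
  (L.map fun e => (e.1, e.2.reverse)).reverse

lemma reverseLabels_reverseLabels (L : List DecoratedPath) :
    reverseLabels (reverseLabels L) = L := by
  simp [reverseLabels, Function.comp_def]

lemma reverseLabels_append (A B : List DecoratedPath) :
    reverseLabels (A ++ B) = reverseLabels B ++ reverseLabels A := by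
  simp [reverseLabels]

lemma reverseLabels_append_cons (A B : List DecoratedPath) (M : DecoratedPath) :
    reverseLabels (A ++ M :: B) =
      reverseLabels B ++ (M.1, M.2.reverse) :: reverseLabels A := by
  simp [reverseLabels]

lemma labels_reverseLabels (L : List DecoratedPath) :
    labels (reverseLabels L) = (labels L).reverse := by
  induction L with
  | nil => rfl
  | cons e L ih =>
    have := reverseLabels_append_cons [] L e
    rw [List.nil_append] at this
    rw [this, labels_append, ih, labels_cons, labels_cons, List.reverse_append]
    simp [reverseLabels]

lemma zero_reverseLabels {L : List DecoratedPath} (h : ∀ e ∈ L, ∀ x ∈ e.2, x = 0) :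
    ∀ e ∈ reverseLabels L, ∀ x ∈ e.2, x = 0 := by
  intro e he x hx
  simp only [reverseLabels, List.mem_reverse, List.mem_map] at he
  obtain ⟨e, he, rfl⟩ := he
  exact h e he x (List.mem_reverse.1 hx)

lemma reverseLabels_reshuffle_append_cons {A B : List DecoratedPath} {M : DecoratedPath}
    (hA : ∀ e ∈ A, ∀ x ∈ e.2, x = 0) (hM : ¬ ∀ x ∈ M.2, x = 0) :
    reverseLabels (reshuffle (A ++ M :: B)) = reverseLabels A ++ M :: reverseLabels B := by
  rw [reshuffle_append_cons hA hM, reverseLabels_append_cons, List.reverse_reverse]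

/-- The composite leaves `M` fixed and reverses `A` and `B` in place; the zero block stays zero, so
the same `M` is selected the second time. -/
lemma involutive_reverseLabels_reshuffle :
    Function.Involutive fun L => reverseLabels (reshuffle L) := by
  intro L
  dsimp only
  rcases exists_first_nonzero L with h | ⟨A, M, B, rfl, hA, hM⟩
  · rw [reshuffle_of_zero h, reshuffle_of_zero (zero_reverseLabels h), reverseLabels_reverseLabels]
  · rw [reverseLabels_reshuffle_append_cons hA hM,
      reverseLabels_reshuffle_append_cons (zero_reverseLabels hA) hM, reverseLabels_reverseLabels,
      reverseLabels_reverseLabels]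

lemma reshuffle_bijective : Function.Bijective reshuffle := by
  have h : Function.Bijective reverseLabels :=
    (show Function.Involutive _ from reverseLabels_reverseLabels).bijective
  exact (h.of_comp_iff' reshuffle).1 involutive_reverseLabels_reshuffle.bijective

lemma zero_labels_iff {L : List DecoratedPath} :
    (∀ x ∈ labels L, x = 0) ↔ ∀ e ∈ L, ∀ x ∈ e.2, x = 0 := by
  simp only [labels, List.mem_flatten, List.mem_map]
  exact ⟨fun h e he x hx => h x ⟨_, ⟨e, he, rfl⟩, hx⟩,
    by rintro h x ⟨_, ⟨e, he, rfl⟩, hx⟩; exact h e he x hx⟩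

lemma validAbove_of_zero {L : List DecoratedPath} (h : ∀ e ∈ L, ∀ x ∈ e.2, x = 0) :
    ValidAbove L := by
  rintro A B rfl -
  exact zero_labels_iff.2 fun e he => h e (List.mem_append_left _ he)

/-- Prefixes ending before `M` carry only zeros. The prefix ending with `M` is decisive, and every
longer one still has the labels of `M.2.dropLast` before its last label. -/
lemma validAbove_append_cons_iff {A B : List DecoratedPath} {M : DecoratedPath}
    (hA : ∀ e ∈ A, ∀ x ∈ e.2, x = 0) (hM : ¬ ∀ x ∈ M.2, x = 0) :
    ValidAbove (A ++ M :: B) ↔ ¬ ∀ x ∈ M.2.dropLast, x = 0 := by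
  have hM0 : M.2 ≠ [] := by rintro h; simp [h] at hM
  constructor
  · intro hv hz
    refine hM fun x hx => hv (A ++ [M]) B (by simp) (fun y hy => ?_) x (by simp [hx])
    rw [labels_append, labels_cons, labels_nil, List.append_nil,
      List.dropLast_append_of_ne_nil hM0, List.mem_append] at hy
    rcases hy with hy | hy
    · exact zero_labels_iff.2 hA y hy
    · exact hz y hy
  · intro hz X Y hXY hX
    rcases List.append_eq_append_iff.1 hXY.symm with ⟨C, rfl, -⟩ | ⟨C, rfl, hC⟩
    · exact zero_labels_iff.2 fun e he => hA e (List.mem_append_left _ he)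
    · rcases C with _ | ⟨M', C⟩
      · rw [List.append_nil]
        exact zero_labels_iff.2 hA
      · obtain ⟨rfl, -⟩ := List.cons.inj hC
        refine absurd (fun x hx => hX x ?_) hz
        rw [labels_append, labels_cons, ← List.dropLast_append_getLast hM0, List.append_assoc,
          List.dropLast_append_of_ne_nil (by simp), List.dropLast_append_of_ne_nil (by simp)]
        simp [hx]

lemma validBelow_iff_reverseLabels (L : List DecoratedPath) :
    ValidBelow L ↔ ValidAbove (reverseLabels L) := by
  constructor
  · intro h A B hAB hz
    have hL : L = reverseLabels B ++ reverseLabels A := by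
      rw [← reverseLabels_append, ← hAB, reverseLabels_reverseLabels]
    have := h _ _ hL
    rw [labels_reverseLabels, List.tail_reverse] at this
    simpa using this (by simpa using hz)
  · rintro h A B rfl hz
    have := h _ _ (reverseLabels_append A B)
    rw [labels_reverseLabels, List.dropLast_reverse] at this
    simpa using this (by simpa using hz)

/-- After the mirror reflection the middle excursion is again `M` with its original labels, and
validity depends on nothing else. -/
lemma validBelow_reshuffle_iff (L : List DecoratedPath) :
    ValidBelow (reshuffle L) ↔ ValidAbove L := by
  rw [validBelow_iff_reverseLabels]
  rcases exists_first_nonzero L with h | ⟨A, M, B, rfl, hA, hM⟩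
  · rw [reshuffle_of_zero h]
    exact iff_of_true (validAbove_of_zero (zero_reverseLabels h)) (validAbove_of_zero h)
  · rw [reverseLabels_reshuffle_append_cons hA hM, validAbove_append_cons_iff hA hM,
      validAbove_append_cons_iff (zero_reverseLabels hA) hM]

lemma isExcursionList_reshuffle_iff (L : List DecoratedPath) :
    IsExcursionList (reshuffle L) ↔ IsExcursionList L := by
  rcases exists_first_nonzero L with h | ⟨A, M, B, rfl, hA, hM⟩
  · rw [reshuffle_of_zero h]
  · rw [reshuffle_append_cons hA hM]
    simp only [IsExcursionList, List.forall_mem_append, List.forall_mem_cons, List.length_reverse]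
    tauto

lemma labels_reshuffle_perm (L : List DecoratedPath) : (labels (reshuffle L)).Perm (labels L) := by
  rcases exists_first_nonzero L with h | ⟨A, M, B, rfl, hA, hM⟩
  · rw [reshuffle_of_zero h]
  · rw [reshuffle_append_cons hA hM]
    simp only [labels_append, labels_cons]
    refine List.perm_append_comm.trans ?_
    rw [List.append_assoc]
    refine ((List.reverse_perm _).append_right _).trans ?_
    exact List.perm_append_comm_assoc _ _ _

end Reshuffle

/-! ### Both classes encoded by valid lists of excursions -/

section Encoding

namespace FinitePerm

/-- `lab G m` lists the values of `G` on `0, …, m` except the one at `z m`, in such a way that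
`Valid` expresses maximality of the gridline. -/
structure IsLabelling (r : ℕ → ℕ → Prop) (lab : (ℕ → ℕ) → ℕ → List ℕ) (z : ℕ → ℕ)
    (Valid : List DecoratedPath → Prop) : Prop where
  rel : r = (· < ·) ∨ r = (· > ·)
  z_le : ∀ m, z m ≤ m
  length : ∀ G m, (lab G m).length = m
  surj : ∀ l : List ℕ, ∃ G, G (z l.length) = 0 ∧ lab G l.length = l
  inj : ∀ G G' m, G (z m) = G' (z m) → lab G m = lab G' m → ∀ g ≤ m, G g = G' g
  sum : ∀ G m, G (z m) = 0 → ∑ g ∈ Finset.range (m + 1), G g = (lab G m).sum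
  congr : ∀ G G' m, (∀ g ≤ m, G g = G' g) → lab G m = lab G' m
  valid : ∀ (H : ℕ → ℕ) (m : ℕ) (h : IsHeight H m) (L : List DecoratedPath), IsExcursionList L →
    (L.map Prod.fst).sum = h.toDyckWord → ∀ G, labels L = lab G m →
    ((∀ g ≤ m, H g = g → (∀ g' ≤ m, r g' g → G g' = 0) → G g = 0) ↔ G (z m) = 0 ∧ Valid L)

lemma isLabelling_above : IsLabelling (· < ·) (fun G m => (List.range m).map fun i => G (i + 1))
    (fun _ => 0) ValidAbove where
  rel := Or.inl rfl
  z_le := by simp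
  length := by simp
  -- The prepended `0` is the empty, unlabelled gap `0`.
  surj l := ⟨fun i => (0 :: l).getD i 0, by simp,
    List.ext_getElem (by simp) fun i h1 h2 => by simp [h2]⟩
  inj G G' m h0 h g hg := by
    rcases g with _ | g
    · exact h0
    · exact List.map_inj_left.1 h g (by simpa using hg)
  sum G m h0 := by
    rw [Finset.sum_range_succ', h0, add_zero]
    rfl
  congr G G' m h := List.map_congr_left fun i hi => h _ (by simpa using hi)
  valid _ _ h _ hL hs _ hG := h.validAbove_iff hL hs hG

lemma isLabelling_below : IsLabelling (· > ·) (fun G m => (List.range m).map G)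
    id ValidBelow where
  rel := Or.inr rfl
  z_le := by simp
  length := by simp
  -- The default value `0` is what makes the unlabelled gap `l.length` empty.
  surj l := ⟨fun i => l.getD i 0, by simp,
    List.ext_getElem (by simp) fun i h1 h2 => by simp [h2]⟩
  inj G G' m h0 h g hg := by
    rcases hg.lt_or_eq with hg | rfl
    · exact List.map_inj_left.1 h g (by simpa using hg)
    · exact h0
  sum G m h0 := by
    rw [Finset.sum_range_succ, show G m = 0 from h0, add_zero]
    rfl
  congr G G' m h := List.map_congr_left fun i hi => h _ (by simp at hi; omega)
  valid _ _ h _ hL hs _ hG := h.validBelow_iff hL hs hG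

/-- The excursions of the left path of `π` at its rightmost gridline are `L`. -/
def Encodes (r : ℕ → ℕ → Prop) (lab : (ℕ → ℕ) → ℕ → List ℕ) (π : FinitePerm)
    (L : List DecoratedPath) : Prop :=
  ∃ m, IsGreatest {m | π.Gridding r m} m ∧
    IsExcursionDecomposition (π.leftPath m) (lab (π.gapCount m) m) L

variable {r : ℕ → ℕ → Prop} {lab : (ℕ → ℕ) → ℕ → List ℕ} {z : ℕ → ℕ}
  {Valid : List DecoratedPath → Prop}

lemma isExcursionDecomposition_leftPath_iff {π : FinitePerm} {m : ℕ} (hm : m ≤ π.size)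
    {h : List ℕ} {L : List DecoratedPath} :
    IsExcursionDecomposition (π.leftPath m) h L ↔ IsExcursionList L ∧
      (L.map Prod.fst).sum = (isHeight_leftHeight hm).toDyckWord ∧ labels L = h := by
  rw [leftPath_eq, ← isExcursionDecomposition_iff]
  rfl

lemma exists_encodes (hlab : IsLabelling r lab z Valid) {π : FinitePerm}
    (hπ : ∃ m, π.Gridding r m) :
    ∃ L, (IsExcursionList L ∧ Valid L) ∧ π.Encodes r lab L := by
  have hbdd : BddAbove {m | π.Gridding r m} := ⟨π.size, fun m hm => hm.1⟩
  have hg : IsGreatest {m | π.Gridding r m} (sSup {m | π.Gridding r m}) :=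
    ⟨Nat.sSup_mem hπ hbdd, fun m hm => le_csSup hbdd hm⟩
  generalize sSup {m | π.Gridding r m} = m at hg
  have hm : m ≤ π.size := hg.1.1
  obtain ⟨L, hL⟩ := exists_isExcursionDecomposition
    (w := (isHeight_leftHeight hm).toDyckWord) (h := lab (π.gapCount m) m)
    (by rw [hlab.length, IsHeight.semilength_toDyckWord])
  have hL' := isExcursionDecomposition_iff.1 hL
  refine ⟨L, ⟨hL'.1, ?_⟩, m, hg, (isExcursionDecomposition_leftPath_iff hm).2 hL'⟩
  exact ((hlab.valid _ _ _ _ hL'.1 hL'.2.1 _ hL'.2.2).1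
    ((isGreatest_gridding_iff hlab.rel).1 hg).2).2

lemma Encodes.unique {π : FinitePerm} {L L' : List DecoratedPath} (h : π.Encodes r lab L)
    (h' : π.Encodes r lab L') : L = L' := by
  obtain ⟨m, hg, hL⟩ := h
  obtain ⟨m', hg', hL'⟩ := h'
  obtain rfl := hg.unique hg'
  rw [isExcursionDecomposition_leftPath_iff hg.1.1] at hL hL'
  exact hL.1.eq_of_sum_eq hL'.1 (hL.2.1.trans hL'.2.1.symm) (hL.2.2.trans hL'.2.2.symm)

/-- Any path and gap counts come from some gridding; validity, with the unlabelled gap empty,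
ensures that its gridline is the rightmost one. -/
lemma exists_encodes_of_valid (hlab : IsLabelling r lab z Valid) {L : List DecoratedPath}
    (hL : IsExcursionList L ∧ Valid L) :
    ∃ π : FinitePerm, (∃ m, π.Gridding r m) ∧ π.Encodes r lab L := by
  obtain ⟨H, hH, hw⟩ : ∃ H, ∃ h : IsHeight H (labels L).length,
      (L.map Prod.fst).sum = h.toDyckWord := by
    rw [hL.1.length_labels]
    exact DyckWord.exists_isHeight _
  obtain ⟨G, hG0, hG⟩ := hlab.surj (labels L)
  obtain ⟨π, hπ, hπH, hπG⟩ := exists_gridding (G := G) hH hlab.rel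
  have hs : (L.map Prod.fst).sum = (isHeight_leftHeight hπ.1).toDyckWord := by
    rw [hw]
    ext1
    change columns _ = columns _
    congr 1
    refine List.map_congr_left fun c hc => ?_
    rw [List.mem_range] at hc
    rw [hπH _ (by omega), hπH _ (by omega)]
  have hl : labels L = lab (π.gapCount (labels L).length) (labels L).length := by
    rw [hlab.congr _ _ _ hπG, hG]
  have hz : π.gapCount (labels L).length (z (labels L).length) = 0 ∧ Valid L :=
    ⟨(hπG _ (hlab.z_le _)).trans hG0, hL.2⟩
  refine ⟨π, ⟨_, hπ⟩, _, (isGreatest_gridding_iff hlab.rel).2 ⟨hπ, ?_⟩,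
    (isExcursionDecomposition_leftPath_iff hπ.1).2 ⟨hL.1, hs, hl⟩⟩
  exact (hlab.valid _ _ _ _ hL.1 hs _ hl).2 hz

lemma Encodes.gapCount_eq_zero (hlab : IsLabelling r lab z Valid) {π : FinitePerm} {m : ℕ}
    {L : List DecoratedPath} (hg : IsGreatest {m | π.Gridding r m} m)
    (hL : IsExcursionDecomposition (π.leftPath m) (lab (π.gapCount m) m) L) :
    π.gapCount m (z m) = 0 := by
  rw [isExcursionDecomposition_leftPath_iff hg.1.1] at hL
  exact ((hlab.valid _ _ _ _ hL.1 hL.2.1 _ hL.2.2).1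
    ((isGreatest_gridding_iff hlab.rel).1 hg).2).1

/-- The number of labels is `m`, the path gives the heights, and the labels with the empty
unlabelled gap give all gap counts. -/
lemma Encodes.eq (hlab : IsLabelling r lab z Valid) {π π' : FinitePerm}
    {L : List DecoratedPath} (h : π.Encodes r lab L) (h' : π'.Encodes r lab L) : π = π' := by
  obtain ⟨m, hg, hL⟩ := h
  obtain ⟨m', hg', hL'⟩ := h'
  have h0 := Encodes.gapCount_eq_zero hlab hg hL
  have h0' := Encodes.gapCount_eq_zero hlab hg' hL'
  rw [isExcursionDecomposition_leftPath_iff hg.1.1] at hL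
  rw [isExcursionDecomposition_leftPath_iff hg'.1.1] at hL'
  obtain rfl : m = m' := by
    rw [← hlab.length (π.gapCount m) m, ← hL.2.2, hL'.2.2, hlab.length]
  have hr : IsStrictTotalOrder ℕ r := by
    rcases hlab.rel with rfl | rfl <;> infer_instance
  refine eq_of_leftHeight_eq_of_gapCount_eq hg.1 hg'.1 (fun c hc => ?_)
    (hlab.inj _ _ _ (h0.trans h0'.symm) (hL.2.2.symm.trans hL'.2.2))
  have := columns_injective (congrArg DyckWord.toList (hL.2.1.symm.trans hL'.2.1))
  rw [← (isHeight_leftHeight hg.1.1).sum_increments hc,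
    ← (isHeight_leftHeight hg'.1.1).sum_increments hc, ← take_increments _ hc, this,
    take_increments _ hc]

lemma Encodes.size_eq (hlab : IsLabelling r lab z Valid) {π : FinitePerm}
    {L : List DecoratedPath} (h : π.Encodes r lab L) :
    π.size = (labels L).length + (labels L).sum := by
  obtain ⟨m, hg, hL⟩ := h
  have h0 := Encodes.gapCount_eq_zero hlab hg hL
  rw [isExcursionDecomposition_leftPath_iff hg.1.1] at hL
  rw [FinitePerm.size_eq hg.1.1, hL.2.2, hlab.length, hlab.sum _ _ h0]

/-- Permutations in a juxtaposition class correspond to valid sequences of excursions. -/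
lemma exists_equiv_encodes (hlab : IsLabelling r lab z Valid) {S : Set FinitePerm}
    (hS : ∀ π, π ∈ S ↔ ∃ m, π.Gridding r m) :
    ∃ e : S ≃ {L // IsExcursionList L ∧ Valid L}, ∀ π : S, π.1.Encodes r lab (e π).1 := by
  choose f hf hf' using fun π : S => exists_encodes hlab ((hS π.1).1 π.2)
  refine ⟨Equiv.ofBijective (fun π => ⟨f π, hf π⟩) ⟨fun π π' h => ?_, fun L => ?_⟩, hf'⟩
  · have h1 := hf' π'
    rw [← Subtype.mk.inj h] at h1
    exact Subtype.ext ((hf' π).eq hlab h1)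
  · obtain ⟨π, hπ, hL⟩ := exists_encodes_of_valid hlab L.2
    exact ⟨⟨π, (hS π).2 hπ⟩, Subtype.ext ((hf' _).unique hL)⟩

end FinitePerm

end Encoding

theorem mainTheorem3 :
    ∃ φ : FinitePerm.juxtaposition ![3, 1, 2] ![2, 1] ≃
        FinitePerm.juxtaposition ![3, 1, 2] ![1, 2],
      (∀ π, (φ π).1.size = π.1.size) ∧
      ∀ π, ∃ (m m' : ℕ) (L : List DecoratedPath),
        π.1.IsRightmostGridding ![3, 1, 2] ![2, 1] m ∧
        (φ π).1.IsRightmostGridding ![3, 1, 2] ![1, 2] m' ∧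
        IsExcursionDecomposition (π.1.leftPath m) (π.1.lengthsAbove m) L ∧
        IsExcursionDecomposition ((φ π).1.leftPath m') ((φ π).1.lengthsBelow m')
          (reshuffle L) := by
  obtain ⟨e₁, h₁⟩ := FinitePerm.exists_equiv_encodes FinitePerm.isLabelling_above
    (S := FinitePerm.juxtaposition ![3, 1, 2] ![2, 1]) fun π => exists_congr π.isGridding_21_iff
  obtain ⟨e₂, h₂⟩ := FinitePerm.exists_equiv_encodes FinitePerm.isLabelling_below
    (S := FinitePerm.juxtaposition ![3, 1, 2] ![1, 2]) fun π => exists_congr π.isGridding_12_iff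
  -- Reshuffling matches the two validity conditions, so it restricts to a bijection between the two
  -- sets of codes.
  let R : {L // IsExcursionList L ∧ ValidAbove L} ≃ {L // IsExcursionList L ∧ ValidBelow L} :=
    (Equiv.ofBijective reshuffle reshuffle_bijective).subtypeEquiv fun L => by
      rw [Equiv.ofBijective_apply, isExcursionList_reshuffle_iff, validBelow_reshuffle_iff]
  let φ := (e₁.trans R).trans e₂.symm
  have hφ : ∀ π, (φ π).1.Encodes (· > ·) (fun G m => (List.range m).map G)
      (reshuffle (e₁ π).1) := fun π => by
    have := h₂ (φ π)
    rwa [show e₂ (φ π) = R (e₁ π) from e₂.apply_symm_apply _] at this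
  refine ⟨φ, fun π => ?_, fun π => ?_⟩
  · rw [(h₁ π).size_eq FinitePerm.isLabelling_above, (hφ π).size_eq FinitePerm.isLabelling_below,
      (labels_reshuffle_perm _).length_eq, (labels_reshuffle_perm _).sum_eq]
  · obtain ⟨m, hm, hL⟩ := h₁ π
    obtain ⟨m', hm', hL'⟩ := hφ π
    refine ⟨m, m', (e₁ π).1, ?_, ?_, hL, hL'⟩
    · simpa only [FinitePerm.IsRightmostGridding, FinitePerm.isGridding_21_iff] using hm
    · simpa only [FinitePerm.IsRightmostGridding, FinitePerm.isGridding_12_iff] using hm'
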